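/- Let $X$ be a real Banach space and let $C \subset X$ be a closed cone with nonempty interior, that is, a closed convex set with $tC \subset C$ for all $t \ge 0$ and $C \cap (-C) = \{0\}$. Write $x \le y$ when $y - x \in C$, and assume that $C$ is normal: there is a constant $\kappa > 0$ such that $\|x\| \le \kappa \|y\|$ whenever $0 \le x \le y$. Let $f : \operatorname{int} C \to \operatorname{int} C$ be order-preserving ($x \le y$ implies $f(x) \le f(y)$) and subhomogeneous ($f(tx) \le t f(x)$ for all $t \ge 1$ and $x \in \operatorname{int} C$). Let $\gamma$ be a measure of non-compactness on $X$, that is, a nonnegative real-valued function of the bounded subsets of $X$ such that $\gamma(B) = 0$ if and only if $\overline{B}$ is compact, $\gamma(cB) = |c|\gamma(B)$, $\gamma(A + B) \le \gamma(A) + \gamma(B)$ and $\gamma(A \cup B) = \max\{\gamma(A), \gamma(B)\}$ for all bounded $A, B \subset X$ and $c \in \mathbb{R}$ (for example, the Kuratowski or the ball measure of non-compactness). Suppose that $f$ is $\gamma$-condensing: $\gamma(f(B)) < \gamma(B)$ for every bounded set $B \subset \operatorname{int} C$ with $\gamma(B) > 0$. Let $0 < \lambda < 1$ and $f_\lambda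 = \lambda f + (1 - \lambda)\operatorname{id}$. If $f$ has a fixed point in $\operatorname{int} C$, then for every $x \in \operatorname{int} C$ the iterates $f_\lambda^k(x)$ converge in norm, as $k \to \infty$, to a fixed point of $f$ in $\operatorname{int} C$. -/

import Mathlib

open Set Filter Topology
open scoped Pointwise

namespace ConeIteration

/-! ### Cones and maps on their interior

A closed cone is a `ProperCone ℝ X` (closed, convex, stable under multiplication by all `t ≥ 0`)
with `C ∩ -C = {0}`.  The order it induces is `x ≤ y ↔ y - x ∈ C`. -/

section Cone

variable {X : Type*} [NormedAddCommGroup X] [NormedSpace ℝ X]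

/-- `C ∩ (-C) = {0}`. -/
def IsPointedClosedCone (C : ProperCone ℝ X) : Prop :=
  (C : Set X) ∩ -(C : Set X) = {0}

/-- The partial order induced by the cone: `x ≤ y` when `y - x ∈ C`. -/
def ConeLE (C : ProperCone ℝ X) (x y : X) : Prop := y - x ∈ C

/-- `C` is normal: `‖x‖ ≤ κ ‖y‖` whenever `0 ≤ x ≤ y`, for some constant `κ > 0`. -/
def IsNormalCone (C : ProperCone ℝ X) : Prop :=
  ∃ κ : ℝ, 0 < κ ∧ ∀ x y : X, ConeLE C 0 x → ConeLE C x y → ‖x‖ ≤ κ * ‖y‖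

/-- `f` is order-preserving on `D`. -/
def OrderPreservingOn (C : ProperCone ℝ X) (D : Set X) (f : X → X) : Prop :=
  ∀ x ∈ D, ∀ y ∈ D, ConeLE C x y → ConeLE C (f x) (f y)

/-- `f` is subhomogeneous on `D`: `f (t x) ≤ t f x` for `t ≥ 1` (used for `D = int C`, which is
stable under multiplication by such `t`). -/
def SubhomogeneousOn (C : ProperCone ℝ X) (D : Set X) (f : X → X) : Prop :=
  ∀ x ∈ D, ∀ t : ℝ, 1 ≤ t → ConeLE C (f (t • x)) (t • f x)

/-- The averaged map `f_s = s f + (1 - s) id`. -/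
def averagedMap (s : ℝ) (f : X → X) : X → X := fun x => s • f x + (1 - s) • x

end Cone

/-! ### Measures of non-compactness -/

section MNC

variable {X : Type*} [NormedAddCommGroup X] [NormedSpace ℝ X]

/-- `γ` is a measure of non-compactness on `X`: a nonnegative function of the bounded subsets of
`X` (its values on unbounded sets are irrelevant) which vanishes exactly on the relatively compact
sets, is a seminorm, and takes a union of two sets to the maximum (so it is monotone).
Invariance under convex hulls is often required too; leaving it out only enlarges the class.
The Kuratowski and the ball measure belong to it, see `isMNC_kuratowski` and `isMNC_ball`. -/
structure IsMeasureOfNoncompactness (γ : Set X → ℝ) : Prop where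
  nonneg : ∀ B, Bornology.IsBounded B → 0 ≤ γ B
  eq_zero_iff : ∀ B, Bornology.IsBounded B → (γ B = 0 ↔ IsCompact (closure B))
  smul : ∀ (c : ℝ) (B : Set X), Bornology.IsBounded B → γ (c • B) = |c| * γ B
  add_le : ∀ A B, Bornology.IsBounded A → Bornology.IsBounded B → γ (A + B) ≤ γ A + γ B
  union : ∀ A B, Bornology.IsBounded A → Bornology.IsBounded B → γ (A ∪ B) = max (γ A) (γ B)

/-- `f` is `γ`-condensing on `D`: `γ (f B) < γ B` for every bounded `B ⊆ D` which is not
relatively compact, that is, which has `γ B > 0`. -/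
def CondensingOn (γ : Set X → ℝ) (D : Set X) (f : X → X) : Prop :=
  ∀ B ⊆ D, Bornology.IsBounded B → 0 < γ B → γ (f '' B) < γ B

/-- The infimum of the `d > 0` such that `B` has a finite cover by sets `s` with `P d s`. -/
noncomputable def coverInf (P : ℝ → Set X → Prop) (B : Set X) : ℝ :=
  sInf {d : ℝ | 0 < d ∧ ∃ T : Set (Set X), T.Finite ∧ (∀ s ∈ T, P d s) ∧ B ⊆ ⋃₀ T}

/-- The Kuratowski measure of non-compactness: finite covers by sets of diameter at most `d`. -/
noncomputable def kuratowskiMNC (B : Set X) : ℝ :=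
  coverInf (fun d s => ∀ x ∈ s, ∀ y ∈ s, dist x y ≤ d) B

/-- The ball measure of non-compactness: finite covers by (subsets of) balls of radius `d`. -/
noncomputable def ballMNC (B : Set X) : ℝ :=
  coverInf (fun d s => ∃ x, s ⊆ Metric.closedBall x d) B

/-- What `coverInf P` needs in order to be a measure of non-compactness. -/
structure Admissible (P : ℝ → Set X → Prop) : Prop where
  mono : ∀ d e s, d ≤ e → P d s → P e s
  smul : ∀ d s (c : ℝ), P d s → P (|c| * d) (c • s)
  add : ∀ d e s t, P d s → P e t → P (d + e) (s + t)
  ball : ∀ x d, 0 < d → P d (Metric.closedBall x (d / 2))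
  sub_ball : ∀ d s, P d s → ∃ x, s ⊆ Metric.closedBall x d

theorem Admissible.isMNC [CompleteSpace X] {P : ℝ → Set X → Prop} (h : Admissible P) :
    IsMeasureOfNoncompactness (coverInf P) := by
  -- `Q d B`: `B` has a finite cover by sets satisfying `P d`
  set Q : ℝ → Set X → Prop := fun d B =>
    ∃ T : Set (Set X), T.Finite ∧ (∀ s ∈ T, P d s) ∧ B ⊆ ⋃₀ T with hQ
  have bdd : ∀ B, BddBelow {d : ℝ | 0 < d ∧ Q d B} := fun B => ⟨0, fun d hd => hd.1.le⟩
  have le_of : ∀ d B, 0 < d → Q d B → coverInf P B ≤ d := fun d B hd hq =>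
    csInf_le (bdd B) ⟨hd, hq⟩
  have non0 : ∀ B, 0 ≤ coverInf P B := fun B => Real.sInf_nonneg fun d hd => hd.1.le
  have Qmono : ∀ d e B, d ≤ e → Q d B → Q e B := by
    rintro d e B hde ⟨T, hT, hP, hB⟩
    exact ⟨T, hT, fun s hs => h.mono d e s hde (hP s hs), hB⟩
  have nonempty : ∀ B, Bornology.IsBounded B → ({d : ℝ | 0 < d ∧ Q d B}).Nonempty := by
    intro B hB
    obtain ⟨r, hr⟩ := hB.subset_closedBall (0 : X)
    refine ⟨2 * (|r| + 1), by positivity, {Metric.closedBall 0 (2 * (|r| + 1) / 2)},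
      finite_singleton _, ?_, ?_⟩
    · rintro s rfl
      exact h.ball _ _ (by positivity)
    · rw [sUnion_singleton]
      refine hr.trans (Metric.closedBall_subset_closedBall ?_)
      linarith [le_abs_self r]
  have Q_of_lt : ∀ B d, Bornology.IsBounded B → coverInf P B < d → Q d B := by
    intro B d hB hd
    obtain ⟨e, he, hed⟩ := exists_lt_of_csInf_lt (nonempty B hB) hd
    exact Qmono e d B hed.le he.2
  have Qsmul : ∀ d B (c : ℝ), Q d B → Q (|c| * d) (c • B) := by
    rintro d B c ⟨T, hT, hP, hB⟩
    refine ⟨(fun s => c • s) '' T, hT.image _, ?_, ?_⟩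
    · rintro _ ⟨s, hs, rfl⟩
      exact h.smul _ _ _ (hP s hs)
    · rintro _ ⟨x, hx, rfl⟩
      obtain ⟨s, hs, hxs⟩ := hB hx
      exact ⟨c • s, ⟨s, hs, rfl⟩, smul_mem_smul_set hxs⟩
  have mono : ∀ A B, A ⊆ B → Bornology.IsBounded B → coverInf P A ≤ coverInf P B := by
    intro A B hAB hB
    refine le_of_forall_gt_imp_ge_of_dense fun d hd => ?_
    obtain ⟨T, hT, hP, hc⟩ := Q_of_lt B d hB hd
    exact le_of d A ((non0 B).trans_lt hd) ⟨T, hT, hP, hAB.trans hc⟩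
  have smul_le : ∀ (c : ℝ) (B : Set X), c ≠ 0 → Bornology.IsBounded B →
      coverInf P (c • B) ≤ |c| * coverInf P B := by
    intro c B hc hB
    have hc' : 0 < |c| := abs_pos.mpr hc
    refine le_of_forall_gt_imp_ge_of_dense fun d hd => ?_
    have hd0 : 0 < d := (mul_nonneg hc'.le (non0 B)).trans_lt hd
    have h1 : coverInf P B < d / |c| := by
      rw [lt_div_iff₀ hc']; linarith
    have h2 := Qsmul _ _ c (Q_of_lt B _ hB h1)
    rw [mul_div_cancel₀ _ hc'.ne'] at h2
    exact le_of d _ hd0 h2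
  refine ⟨fun B _ => non0 B, fun B hB => ?_, fun c B hB => ?_, fun A B hA hB => ?_,
    fun A B hA hB => ?_⟩
  · have key : coverInf P B = 0 ↔ TotallyBounded B := by
      rw [Metric.totallyBounded_iff]
      constructor
      · intro h0 ε hε
        obtain ⟨T, hT, hP, hc⟩ := Q_of_lt B (ε / 2) hB (by rw [h0]; positivity)
        choose! x hx using fun s hs => h.sub_ball _ s (hP s hs)
        refine ⟨x '' T, hT.image _, fun y hy => ?_⟩
        obtain ⟨s, hs, hys⟩ := hc hy
        simp only [mem_iUnion]
        exact ⟨x s, ⟨s, hs, rfl⟩, Metric.closedBall_subset_ball (by linarith) (hx s hs hys)⟩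
      · intro ht
        refine le_antisymm (le_of_forall_gt_imp_ge_of_dense fun d hd => ?_) (non0 B)
        obtain ⟨t, htf, hts⟩ := ht (d / 2) (by positivity)
        refine le_of d B hd ⟨(fun x => Metric.closedBall x (d / 2)) '' t, htf.image _, ?_, ?_⟩
        · rintro _ ⟨x, _, rfl⟩
          exact h.ball x d hd
        · intro y hy
          obtain ⟨x, hx, hyx⟩ := mem_iUnion₂.mp (hts hy)
          exact ⟨_, ⟨x, hx, rfl⟩, Metric.ball_subset_closedBall hyx⟩
    rw [key, isCompact_iff_totallyBounded_isComplete, totallyBounded_closure]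
    exact ⟨fun hh => ⟨hh, isClosed_closure.isComplete⟩, fun hh => hh.1⟩
  · rcases eq_or_ne c 0 with rfl | hc
    · rw [abs_zero, zero_mul]
      refine le_antisymm (le_of_forall_gt_imp_ge_of_dense fun d hd => ?_) (non0 _)
      refine le_of d _ hd ⟨{Metric.closedBall 0 (d / 2)}, finite_singleton _, ?_, ?_⟩
      · rintro s rfl
        exact h.ball _ _ hd
      · rintro _ ⟨x, _, rfl⟩
        have hd' : (0 : ℝ) ≤ d / 2 := by linarith
        simpa using hd'
    · refine le_antisymm (smul_le c B hc hB) ?_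
      have h1 := smul_le c⁻¹ (c • B) (inv_ne_zero hc) (hB.smul₀ c)
      rw [inv_smul_smul₀ hc, abs_inv] at h1
      have hc' : 0 < |c| := abs_pos.mpr hc
      calc |c| * coverInf P B ≤ |c| * (|c|⁻¹ * coverInf P (c • B)) := by gcongr
        _ = coverInf P (c • B) := by rw [← mul_assoc, mul_inv_cancel₀ hc'.ne', one_mul]
  · refine le_of_forall_pos_le_add fun ε hε => ?_
    obtain ⟨T, hT, hP, hc⟩ := Q_of_lt A (coverInf P A + ε / 2) hA (by linarith)
    obtain ⟨T', hT', hP', hc'⟩ := Q_of_lt B (coverInf P B + ε / 2) hB (by linarith)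
    refine le_of _ _ (by linarith [non0 A, non0 B]) ⟨image2 (· + ·) T T', hT.image2 _ hT', ?_, ?_⟩
    · rintro _ ⟨s, hs, t, ht, rfl⟩
      have h3 := h.add _ _ s t (hP s hs) (hP' t ht)
      exact h.mono _ _ _ (by linarith) h3
    · rintro _ ⟨a, ha, b, hb, rfl⟩
      obtain ⟨s, hs, has⟩ := hc ha
      obtain ⟨t, ht, hbt⟩ := hc' hb
      exact ⟨s + t, ⟨s, hs, t, ht, rfl⟩, add_mem_add has hbt⟩
  · refine le_antisymm (le_of_forall_gt_imp_ge_of_dense fun d hd => ?_)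
      (max_le (mono _ _ subset_union_left (hA.union hB))
        (mono _ _ subset_union_right (hA.union hB)))
    obtain ⟨h1, h2⟩ := max_lt_iff.mp hd
    obtain ⟨T, hT, hP, hc⟩ := Q_of_lt A d hA h1
    obtain ⟨T', hT', hP', hc'⟩ := Q_of_lt B d hB h2
    refine le_of d _ ((non0 A).trans_lt h1) ⟨T ∪ T', hT.union hT', ?_, ?_⟩
    · rintro s (hs | hs)
      exacts [hP s hs, hP' s hs]
    · rw [sUnion_union]
      exact union_subset_union hc hc'

theorem isMNC_ball [CompleteSpace X] :
    IsMeasureOfNoncompactness (ballMNC : Set X → ℝ) := by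
  refine Admissible.isMNC ⟨?_, ?_, ?_, ?_, ?_⟩
  · rintro d e s hde ⟨x, hx⟩
    exact ⟨x, hx.trans (Metric.closedBall_subset_closedBall hde)⟩
  · rintro d s c ⟨x, hx⟩
    refine ⟨c • x, ?_⟩
    rintro _ ⟨y, hy, rfl⟩
    have h1 := Metric.mem_closedBall.mp (hx hy)
    simp only [Metric.mem_closedBall, dist_smul₀, Real.norm_eq_abs]
    gcongr
  · rintro d e s t ⟨x, hx⟩ ⟨y, hy⟩
    refine ⟨x + y, ?_⟩
    rintro _ ⟨a, ha, b, hb, rfl⟩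
    exact (dist_add_add_le a b x y).trans
      (add_le_add (Metric.mem_closedBall.mp (hx ha)) (Metric.mem_closedBall.mp (hy hb)))
  · intro x d hd
    exact ⟨x, Metric.closedBall_subset_closedBall (by linarith)⟩
  · intro d s hs
    exact hs

theorem isMNC_kuratowski [CompleteSpace X] :
    IsMeasureOfNoncompactness (kuratowskiMNC : Set X → ℝ) := by
  refine Admissible.isMNC ⟨?_, ?_, ?_, ?_, ?_⟩
  · intro d e s hde hs x hx y hy
    exact (hs x hx y hy).trans hde
  · rintro d s c hs _ ⟨x, hx, rfl⟩ _ ⟨y, hy, rfl⟩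
    have h1 := hs x hx y hy
    simp only [dist_smul₀, Real.norm_eq_abs]
    gcongr
  · rintro d e s t hs ht _ ⟨a, ha, b, hb, rfl⟩ _ ⟨a', ha', b', hb', rfl⟩
    exact (dist_add_add_le a b a' b').trans (add_le_add (hs a ha a' ha') (ht b hb b' hb'))
  · intro x d hd y hy z hz
    have h1 := Metric.mem_closedBall.mp hy
    have h2 := Metric.mem_closedBall.mp hz
    linarith [dist_triangle_right y z x]
  · intro d s hs
    rcases s.eq_empty_or_nonempty with rfl | ⟨x, hx⟩
    · exact ⟨0, empty_subset _⟩
    · exact ⟨x, fun y hy => Metric.mem_closedBall.mpr (hs y hy x hx)⟩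

end MNC

end ConeIteration

/-!
Comparison in the order of the cone replaces Thompson's metric throughout: an order-preserving
subhomogeneous map `T` satisfies `a ≤ β b → T a ≤ β T b` for all `β ≥ 1`
(`OrderPreservingOn.ratioNonexpansiveOn`), and this property passes to the averaged map `T = f_s`
(`RatioNonexpansiveOn.averagedMap`). By normality it makes `f` and `T` continuous on the interior
of the cone.

If `u` is a fixed point and `u ≤ t x`, `x ≤ t u`, then the whole orbit `xₖ = Tᵏ x` stays in the
order interval between `t⁻¹ u` and `t u`, which is bounded by normality. The orbit differs from its
image under `T` by one point, so that `γ (orbit) ≤ s γ (f (orbit)) + (1 - s) γ (orbit)`, and the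
condensing hypothesis makes the orbit relatively compact (`isCompact_closure_of_condensing`).

Let `y` be a limit point of the orbit and `yᵢ = Tⁱ y`. The least `β ≥ 1` with `xₖ₊₁ ≤ β xₖ`
decreases with `k`, so along the orbit of `y` it is equal to its limit
(`exists_sharp_limit_ratio`): `wᵢ = β yᵢ - yᵢ₊₁` lies in the cone, and if `β > 1` then it is never
an interior point. As `T` is averaged, `wᵢ₊₁ ≥ (1 - s) wᵢ`. Hence
`βⁿ⁺¹ y₀ - yₙ₊₁ = ∑ βⁿ⁻ⁱ wᵢ` is at most a multiple of `wₙ`, so it is not interior either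
(`notMem_interior_of_recursion`). But `βⁿ⁺¹ y₀ - yₙ₊₁` is interior once `βⁿ⁺¹ > t²`, because the
orbit of `y` stays in the same order interval (`smul_sub_mem_interior_of_bounds`). So `β = 1`, that
is, `T y ≤ y`. The same argument with the roles of `yᵢ` and `yᵢ₊₁` exchanged gives `y ≤ T y`. Thus
`y` is a fixed point of `T`, hence of `f`, and the comparison `b⁻¹ y ≤ xₖ ≤ b y`, once it holds
for some `k`, holds for all later ones: the orbit converges to `y`.
-/

namespace ConeIteration

variable {X : Type*} [NormedAddCommGroup X] [NormedSpace ℝ X] {C : ProperCone ℝ X}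

/-! ### Interior points of a cone -/

theorem smul_mem_interior {c : ℝ} (hc : 0 < c) {a : X} (ha : a ∈ interior (C : Set X)) :
    c • a ∈ interior (C : Set X) := by
  refine mem_interior.mpr ⟨(fun z => c⁻¹ • z) ⁻¹' interior (C : Set X), fun z hz => ?_,
    isOpen_interior.preimage (by fun_prop), ?_⟩
  · have h := C.smul_mem (interior_subset hz) hc.le
    rwa [smul_inv_smul₀ hc.ne'] at h
  · simpa [inv_smul_smul₀ hc.ne'] using ha

theorem add_mem_interior {a b : X} (ha : a ∈ interior (C : Set X)) (hb : b ∈ C) :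
    a + b ∈ interior (C : Set X) := by
  refine mem_interior.mpr ⟨(fun z => z - b) ⁻¹' interior (C : Set X), fun z hz => ?_,
    isOpen_interior.preimage (by fun_prop), ?_⟩
  · have h := C.add_mem (interior_subset hz) hb
    rwa [sub_add_cancel] at h
  · simpa using ha

theorem eventually_comparable {y : X} (hy : y ∈ interior (C : Set X)) {b : ℝ} (hb : 1 < b) :
    ∀ᶠ z in 𝓝 y, b • y - z ∈ C ∧ b • z - y ∈ C := by
  have hb' : (b - 1) • y ∈ interior (C : Set X) := smul_mem_interior (by linarith) hy
  have h1 : Tendsto (fun z => b • y - z) (𝓝 y) (𝓝 ((b - 1) • y)) := by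
    have : Continuous fun z => b • y - z := by fun_prop
    simpa [sub_smul] using this.tendsto y
  have h2 : Tendsto (fun z => b • z - y) (𝓝 y) (𝓝 ((b - 1) • y)) := by
    have : Continuous fun z => b • z - y := by fun_prop
    simpa [sub_smul] using this.tendsto y
  filter_upwards [h1 (isOpen_interior.mem_nhds hb'), h2 (isOpen_interior.mem_nhds hb')]
    with z hz1 hz2
  exact ⟨interior_subset hz1, interior_subset hz2⟩

theorem exists_comparison {u : X} (hu : u ∈ interior (C : Set X)) (x : X) :
    ∃ t : ℝ, 1 ≤ t ∧ t • u - x ∈ C := by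
  have h1 : Tendsto (fun t : ℝ => u - t⁻¹ • x) atTop (𝓝 u) := by
    simpa using tendsto_const_nhds (x := u).sub
      ((tendsto_inv_atTop_zero (𝕜 := ℝ)).smul_const x)
  obtain ⟨t, ht, ht1⟩ :=
    ((h1.eventually (isOpen_interior.mem_nhds hu)).and (eventually_ge_atTop (1 : ℝ))).exists
  refine ⟨t, ht1, ?_⟩
  have h := C.smul_mem (interior_subset ht) (zero_le_one.trans ht1)
  rwa [smul_sub, smul_inv_smul₀ (by positivity)] at h

theorem smul_sub_mem_of_le {u a : X} {t r : ℝ} (hu : u ∈ C) (htr : t ≤ r) (h : t • u - a ∈ C) :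
    r • u - a ∈ C := by
  have h1 : _ ∈ C := C.add_mem h (C.smul_mem hu (sub_nonneg.mpr htr))
  convert h1 using 1
  module

theorem mem_interior_of_smul_sub_mem {u a : X} {t : ℝ} (hu : u ∈ interior (C : Set X))
    (ht : 0 < t) (h : t • a - u ∈ C) : a ∈ interior (C : Set X) := by
  have h1 := smul_mem_interior (inv_pos.mpr ht) (add_mem_interior hu h)
  rwa [add_sub_cancel, inv_smul_smul₀ ht.ne'] at h1

theorem smul_sub_mem_interior_of_bounds {u a b : X} {t r : ℝ} (hu : u ∈ interior (C : Set X))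
    (ht : 0 < t) (hr : t ^ 2 < r) (hb : t • b - u ∈ C) (ha : t • u - a ∈ C) :
    r • b - a ∈ interior (C : Set X) := by
  have hr0 : 0 ≤ r := (sq_nonneg t).trans hr.le
  have h := smul_mem_interior (inv_pos.mpr ht) (add_mem_interior
    (smul_mem_interior (sub_pos.mpr hr) hu) (C.add_mem (C.smul_mem hb hr0) (C.smul_mem ha ht.le)))
  have e : (r - t ^ 2) • u + (r • (t • b - u) + t • (t • u - a)) = t • (r • b - a) := by module
  rwa [e, inv_smul_smul₀ ht.ne'] at h

/-- Under normality, closeness in ratio implies closeness in norm. -/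
theorem IsNormalCone.exists_ratio_norm_sub_lt (hC : IsNormalCone C) (y : X) {ε : ℝ} (hε : 0 < ε) :
    ∃ b : ℝ, 1 < b ∧ ∀ z, b • y - z ∈ C → b • z - y ∈ C → ‖z - y‖ < ε := by
  obtain ⟨κ, -, hκ⟩ := hC
  have hlim : Tendsto (fun b : ℝ => κ * ‖(b - b⁻¹) • y‖ + ‖(b - 1) • y‖) (𝓝[>] 1) (𝓝 0) := by
    have hc : ContinuousAt (fun b : ℝ => κ * ‖(b - b⁻¹) • y‖ + ‖(b - 1) • y‖) 1 := by
      have : ContinuousAt (fun b : ℝ => b⁻¹) 1 := continuousAt_inv₀ one_ne_zero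
      fun_prop
    simpa using hc.tendsto.mono_left nhdsWithin_le_nhds
  obtain ⟨b, hb, hb1⟩ := ((hlim.eventually_lt_const hε).and self_mem_nhdsWithin).exists
  have hb1 : 1 < b := hb1
  have hb0 : 0 < b := zero_lt_one.trans hb1
  refine ⟨b, hb1, fun z h1 h2 => lt_of_le_of_lt ?_ hb⟩
  have h3 : ‖b • y - z‖ ≤ κ * ‖(b - b⁻¹) • y‖ := by
    refine hκ _ _ (by simpa [ConeLE] using h1) ?_
    have h4 := C.smul_mem h2 (inv_pos.mpr hb0).le
    rw [smul_sub, inv_smul_smul₀ hb0.ne'] at h4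
    unfold ConeLE
    convert h4 using 1
    module
  calc ‖z - y‖ = ‖(b - 1) • y - (b • y - z)‖ := by congr 1; module
    _ ≤ ‖(b - 1) • y‖ + ‖b • y - z‖ := norm_sub_le _ _
    _ ≤ _ := by linarith

/-- Order intervals of a normal cone are bounded. -/
theorem IsNormalCone.isBounded (hC : IsNormalCone C) {u : X} {t : ℝ} {B : Set X}
    (hB : ∀ z ∈ B, z ∈ C ∧ t • u - z ∈ C) : Bornology.IsBounded B := by
  obtain ⟨κ, -, hκ⟩ := hC
  refine isBounded_iff_forall_norm_le.mpr ⟨κ * ‖t • u‖, fun z hz => ?_⟩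
  exact hκ _ _ (by simpa [ConeLE] using (hB z hz).1) (hB z hz).2

/-! ### Maps that do not increase ratios -/

/-- `T` does not increase ratios at least `1`: `a ≤ β b` implies `T a ≤ β T b` for `β ≥ 1`.
This says that `T` is nonexpansive for Thompson's metric, separately in both directions. -/
def RatioNonexpansiveOn (C : ProperCone ℝ X) (D : Set X) (T : X → X) : Prop :=
  ∀ a ∈ D, ∀ b ∈ D, ∀ β : ℝ, 1 ≤ β → β • b - a ∈ C → β • T b - T a ∈ C

theorem OrderPreservingOn.ratioNonexpansiveOn {f : X → X}
    (hmono : OrderPreservingOn C (interior (C : Set X)) f)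
    (hsub : SubhomogeneousOn C (interior (C : Set X)) f) :
    RatioNonexpansiveOn C (interior (C : Set X)) f := by
  intro a ha b hb β hβ h
  have h1 := hmono a ha (β • b) (smul_mem_interior (by linarith) hb) h
  have h2 := hsub b hb β hβ
  have h3 : _ ∈ C := C.add_mem h1 h2
  convert h3 using 1
  abel

theorem averagedMap_mapsTo {s : ℝ} (hs0 : 0 < s) (hs1 : s < 1) {f : X → X}
    (hf : MapsTo f (interior (C : Set X)) (interior (C : Set X))) :
    MapsTo (averagedMap s f) (interior (C : Set X)) (interior (C : Set X)) := fun _ ha =>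
  add_mem_interior (smul_mem_interior hs0 (hf ha))
    (C.smul_mem (interior_subset ha) (sub_pos.mpr hs1).le)

/-- Passing from `(a, b)` to its image under the averaged map, the gap `β b - a` keeps a fixed
fraction of itself. -/
theorem RatioNonexpansiveOn.averagedMap_gap {D : Set X} {f : X → X}
    (hf : RatioNonexpansiveOn C D f) {s : ℝ} (hs0 : 0 ≤ s) {a b : X}
    (ha : a ∈ D) (hb : b ∈ D) {β : ℝ} (hβ : 1 ≤ β) (h : β • b - a ∈ C) :
    (β • averagedMap s f b - averagedMap s f a) - (1 - s) • (β • b - a) ∈ C := by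
  have h1 := C.smul_mem (hf a ha b hb β hβ h) hs0
  unfold averagedMap
  convert h1 using 1
  module

theorem RatioNonexpansiveOn.averagedMap {D : Set X} {f : X → X}
    (hf : RatioNonexpansiveOn C D f) {s : ℝ} (hs0 : 0 ≤ s) (hs1 : s ≤ 1) :
    RatioNonexpansiveOn C D (averagedMap s f) := by
  intro a ha b hb β hβ h
  have h1 : _ ∈ C :=
    C.add_mem (hf.averagedMap_gap hs0 ha hb hβ h) (C.smul_mem h (sub_nonneg.mpr hs1))
  rwa [sub_add_cancel] at h1

theorem RatioNonexpansiveOn.continuousAt {T : X → X}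
    (hT : RatioNonexpansiveOn C (interior (C : Set X)) T) (hC : IsNormalCone C) {y : X}
    (hy : y ∈ interior (C : Set X)) : ContinuousAt T y := by
  refine Metric.tendsto_nhds.mpr fun ε hε => ?_
  obtain ⟨b, hb, hbε⟩ := hC.exists_ratio_norm_sub_lt (T y) hε
  filter_upwards [eventually_comparable hy hb, isOpen_interior.mem_nhds hy] with z hz hzC
  rw [dist_eq_norm]
  exact hbε _ (hT z hzC y hy b hb.le hz.1) (hT y hy z hzC b hb.le hz.2)

theorem RatioNonexpansiveOn.iterate {D : Set X} {T : X → X} (hT : RatioNonexpansiveOn C D T)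
    (hm : MapsTo T D D) (k : ℕ) : RatioNonexpansiveOn C D T^[k] := by
  induction k with
  | zero => exact fun a _ b _ β _ h => h
  | succ k ih =>
    intro a ha b hb β hβ h
    rw [Function.iterate_succ_apply', Function.iterate_succ_apply']
    exact hT _ (hm.iterate k ha) _ (hm.iterate k hb) β hβ (ih a ha b hb β hβ h)

/-- An orbit converges to a fixed point as soon as it accumulates there. -/
theorem RatioNonexpansiveOn.tendsto_iterate {T : X → X}
    (hT : RatioNonexpansiveOn C (interior (C : Set X)) T) (hC : IsNormalCone C)
    (hm : MapsTo T (interior (C : Set X)) (interior (C : Set X))) {x y : X}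
    (hx : x ∈ interior (C : Set X)) (hy : y ∈ interior (C : Set X)) (hTy : T y = y)
    {φ : ℕ → ℕ} (hφ : Tendsto (fun j => T^[φ j] x) atTop (𝓝 y)) :
    Tendsto (fun k => T^[k] x) atTop (𝓝 y) := by
  refine Metric.tendsto_nhds.mpr fun ε hε => ?_
  obtain ⟨b, hb, hbε⟩ := hC.exists_ratio_norm_sub_lt y hε
  obtain ⟨j, hj⟩ := (hφ.eventually (eventually_comparable hy hb)).exists
  filter_upwards [eventually_ge_atTop (φ j)] with k hk
  obtain ⟨m, rfl⟩ := Nat.exists_eq_add_of_le' hk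
  have hxj := hm.iterate (φ j) hx
  have h1 := hT.iterate hm m _ hxj y hy b hb.le hj.1
  have h2 := hT.iterate hm m y hy _ hxj b hb.le hj.2
  rw [Function.iterate_fixed hTy, ← Function.iterate_add_apply] at h1 h2
  rw [dist_eq_norm]
  exact hbε _ h1 h2

/-! ### Relative compactness of orbits of the averaged map -/

theorem IsMeasureOfNoncompactness.mono {γ : Set X → ℝ} (hγ : IsMeasureOfNoncompactness γ)
    {A B : Set X} (hAB : A ⊆ B) (hB : Bornology.IsBounded B) : γ A ≤ γ B := by
  have h := hγ.union A B (hB.subset hAB) hB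
  rw [union_eq_self_of_subset_left hAB] at h
  exact (le_max_left _ _).trans h.ge

theorem isCompact_closure_of_condensing {γ : Set X → ℝ} (hγ : IsMeasureOfNoncompactness γ)
    {D : Set X} {f : X → X} (hcond : CondensingOn γ D f) {s : ℝ} (hs0 : 0 < s) (hs1 : s < 1)
    {B : Set X} (hBD : B ⊆ D) (hB : Bornology.IsBounded B) (hfB : Bornology.IsBounded (f '' B))
    {x : X} (hBx : B ⊆ {x} ∪ averagedMap s f '' B) : IsCompact (closure B) := by
  have hs1' : 0 < 1 - s := sub_pos.mpr hs1
  rw [← hγ.eq_zero_iff B hB]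
  by_contra h0
  have hpos : 0 < γ B := lt_of_le_of_ne (hγ.nonneg B hB) (Ne.symm h0)
  have himg : averagedMap s f '' B ⊆ s • (f '' B) + (1 - s) • B := by
    rintro _ ⟨z, hz, rfl⟩
    exact add_mem_add (smul_mem_smul_set (mem_image_of_mem f hz)) (smul_mem_smul_set hz)
  have hsum : Bornology.IsBounded (s • (f '' B) + (1 - s) • B) :=
    (hfB.smul₀ s).add (hB.smul₀ (1 - s))
  have hx0 : γ {x} = 0 := (hγ.eq_zero_iff _ Bornology.isBounded_singleton).mpr (by simp)
  have h1 : γ (s • (f '' B) + (1 - s) • B) ≤ s * γ (f '' B) + (1 - s) * γ B := by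
    have h := hγ.add_le _ _ (hfB.smul₀ s) (hB.smul₀ (1 - s))
    rwa [hγ.smul _ _ hfB, hγ.smul _ _ hB, abs_of_pos hs0, abs_of_pos hs1'] at h
  have h2 : γ B ≤ γ (s • (f '' B) + (1 - s) • B) := by
    refine (hγ.mono (hBx.trans (union_subset_union_right _ himg))
      (Bornology.isBounded_singleton.union hsum)).trans ?_
    rw [hγ.union _ _ Bornology.isBounded_singleton hsum, hx0]
    exact max_le (hγ.nonneg _ hsum) le_rfl
  have h3 := mul_lt_mul_of_pos_left (hcond B hBD hB hpos) hs0
  linarith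

/-! ### Ratios along the orbit of a limit point -/

/-- Let `aₖ`, `bₖ` be two orbits. The least ratio `β ≥ 1` with `aₖ ≤ β bₖ` decreases with `k`, so
that along orbits `a'`, `b'` of limit points it is constant: no smaller `β` will do there. -/
theorem exists_sharp_limit_ratio {T : X → X} {D : Set X} (hT : RatioNonexpansiveOn C D T)
    {a b a' b' : ℕ → X} (haD : ∀ k, a k ∈ D) (hbD : ∀ k, b k ∈ D)
    (ha : ∀ k, a (k + 1) = T (a k)) (hb : ∀ k, b (k + 1) = T (b k))
    {φ : ℕ → ℕ} (hφ : Tendsto φ atTop atTop)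
    (ha' : ∀ i, Tendsto (fun j => a (φ j + i)) atTop (𝓝 (a' i)))
    (hb' : ∀ i, Tendsto (fun j => b (φ j + i)) atTop (𝓝 (b' i)))
    (h0 : ∃ β : ℝ, 1 ≤ β ∧ β • b 0 - a 0 ∈ C) :
    ∃ β : ℝ, 1 ≤ β ∧ (∀ i, β • b' i - a' i ∈ C) ∧
      (1 < β → ∀ i, β • b' i - a' i ∉ interior (C : Set X)) := by
  set S : Set ℝ := {β | 1 ≤ β ∧ ∃ k, β • b k - a k ∈ C} with hS
  have hne : S.Nonempty := by
    obtain ⟨β, h1, h2⟩ := h0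
    exact ⟨β, h1, 0, h2⟩
  have hbdd : BddBelow S := ⟨1, fun β hβ => hβ.1⟩
  have hlater : ∀ β : ℝ, 1 ≤ β → ∀ k, β • b k - a k ∈ C → ∀ m, k ≤ m → β • b m - a m ∈ C := by
    intro β hβ k hk m hkm
    induction m, hkm using Nat.le_induction with
    | base => exact hk
    | succ m _ ih =>
      rw [ha, hb]
      exact hT _ (haD m) _ (hbD m) β hβ ih
  have hlim : ∀ β ∈ S, ∀ i, β • b' i - a' i ∈ C := by
    rintro β ⟨h1, k, hk⟩ i
    refine C.isClosed.mem_of_tendsto (((hb' i).const_smul β).sub (ha' i)) ?_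
    filter_upwards [hφ.eventually_ge_atTop k] with j hj
    exact hlater β h1 k hk _ (hj.trans (Nat.le_add_right _ _))
  refine ⟨sInf S, le_csInf hne fun β hβ => hβ.1, fun i => ?_, fun hβ i hi => ?_⟩
  · have hcl : IsClosed {β : ℝ | β • b' i - a' i ∈ C} :=
      C.isClosed.preimage (f := fun β : ℝ => β • b' i - a' i) (by fun_prop)
    exact closure_minimal (fun β hβ => hlim β hβ i) hcl (csInf_mem_closure hne hbdd)
  · -- an interior gap survives a slightly smaller ratio, which then occurs along the orbits
    have hc : Continuous fun β : ℝ => β • b' i - a' i := by fun_prop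
    have hev : ∀ᶠ β in 𝓝[<] sInf S, β • b' i - a' i ∈ interior (C : Set X) :=
      nhdsWithin_le_nhds (hc.continuousAt.eventually (isOpen_interior.mem_nhds hi))
    obtain ⟨β, h1, h2, h3⟩ := (hev.and (Ioo_mem_nhdsLT hβ)).exists
    obtain ⟨j, hj⟩ := ((((hb' i).const_smul β).sub (ha' i)).eventually
      (isOpen_interior.mem_nhds h1)).exists
    exact notMem_of_lt_csInf h3 hbdd ⟨h2.le, φ j + i, interior_subset hj⟩

/-- If each `wₖ₊₁` dominates a positive multiple of `wₖ`, then a nonnegative combination of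
`w₀, …, wₖ` is at most a multiple of `wₖ`, so it is not interior when `wₖ` is not. -/
theorem notMem_interior_of_recursion {w p : ℕ → X} {c : ℝ} (hc : 0 < c) (hwC : ∀ k, w k ∈ C)
    (hw : ∀ k, w (k + 1) - c • w k ∈ C) (hwi : ∀ k, w k ∉ interior (C : Set X)) (h0 : p 0 = w 0)
    (hp : ∀ k, ∃ d e : ℝ, 0 ≤ d ∧ 0 ≤ e ∧ p (k + 1) = d • p k + e • w (k + 1)) (k : ℕ) :
    p k ∉ interior (C : Set X) := by
  have hdom : ∀ k, ∃ M : ℝ, 0 ≤ M ∧ M • w k - p k ∈ C := by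
    intro k
    induction k with
    | zero => exact ⟨1, zero_le_one, by simp [h0]⟩
    | succ k ih =>
      obtain ⟨M, hM, h⟩ := ih
      obtain ⟨d, e, hd, he, hpe⟩ := hp k
      refine ⟨d * (M / c) + e, by positivity, ?_⟩
      have h1 : _ ∈ C := C.add_mem (C.smul_mem h hd)
        (C.smul_mem (hw k) (show 0 ≤ d * (M / c) by positivity))
      rw [hpe]
      convert h1 using 1
      rw [smul_sub (d * (M / c)), smul_smul (d * (M / c)), mul_assoc, div_mul_cancel₀ M hc.ne']
      module
  intro hk
  obtain ⟨M, hM, h⟩ := hdom k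
  refine hwi k (mem_interior_of_smul_sub_mem hk (t := M + 1) (by linarith) ?_)
  have h1 : _ ∈ C := C.add_mem h (hwC k)
  convert h1 using 1
  module

/-- Limit points of an orbit of the averaged map are fixed points, provided that their own orbits
stay between `t⁻¹ u` and `t u`: a sharp limit ratio `β > 1` between consecutive points of such an
orbit, in either direction, would compound to a ratio above `t ^ 2`. -/
theorem averagedMap_eq_self_of_tendsto_iterate (hC : IsPointedClosedCone C)
    (hnormal : IsNormalCone C) {f : X → X}
    (hf : MapsTo f (interior (C : Set X)) (interior (C : Set X)))
    (hfr : RatioNonexpansiveOn C (interior (C : Set X)) f)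
    {s : ℝ} (hs0 : 0 < s) (hs1 : s < 1) {u x y : X} {t : ℝ} (ht : 0 < t)
    (hu : u ∈ interior (C : Set X)) (hx : x ∈ interior (C : Set X))
    (hy : y ∈ interior (C : Set X))
    (hub : ∀ k, t • u - (averagedMap s f)^[k] y ∈ C)
    (hlb : ∀ k, t • (averagedMap s f)^[k] y - u ∈ C)
    {φ : ℕ → ℕ} (hφ : Tendsto φ atTop atTop)
    (hlim : Tendsto (fun j => (averagedMap s f)^[φ j] x) atTop (𝓝 y)) :
    averagedMap s f y = y := by
  have hT := hfr.averagedMap hs0.le hs1.le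
  have hgap := fun a ha b hb β hβ h =>
    hfr.averagedMap_gap hs0.le (a := a) (b := b) (β := β) ha hb hβ h
  have hm := averagedMap_mapsTo hs0 hs1 hf
  set T := averagedMap s f
  have hxk : ∀ k, T^[k] x ∈ interior (C : Set X) := fun k => hm.iterate k hx
  have hyk : ∀ k, T^[k] y ∈ interior (C : Set X) := fun k => hm.iterate k hy
  have hs : ∀ z k, T^[k + 1] z = T (T^[k] z) := fun z k => Function.iterate_succ_apply' T k z
  have hlim' : ∀ i, Tendsto (fun j => T^[φ j + i] x) atTop (𝓝 (T^[i] y)) := by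
    intro i
    induction i with
    | zero => exact hlim
    | succ i ih =>
      have h := (hT.continuousAt hnormal (hyk i)).tendsto.comp ih
      rw [hs]
      exact h.congr fun j => (hs x (φ j + i)).symm
  have hpow : ∀ β : ℝ, 1 < β → ∃ n : ℕ, t ^ 2 < β ^ (n + 1) := by
    intro β hβ
    obtain ⟨n, hn⟩ := pow_unbounded_of_one_lt (t ^ 2) hβ
    exact ⟨n, hn.trans_le (pow_le_pow_right₀ hβ.le n.le_succ)⟩
  have h_le : y - T y ∈ C := by
    obtain ⟨β, hβ, hβC, hβi⟩ := exists_sharp_limit_ratio hT (a := fun k => T^[k + 1] x)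
      (b := fun k => T^[k] x) (a' := fun k => T^[k + 1] y) (b' := fun k => T^[k] y)
      (fun k => hxk (k + 1)) hxk (fun k => hs x (k + 1)) (hs x) hφ
      (fun i => hlim' (i + 1)) hlim' (exists_comparison (hxk 0) _)
    rcases hβ.eq_or_lt with rfl | hβ1
    · simpa using hβC 0
    exfalso
    obtain ⟨n, hn⟩ := hpow β hβ1
    -- `βᵏ⁺¹ y₀ - yₖ₊₁ = β (βᵏ y₀ - yₖ) + wₖ`
    refine notMem_interior_of_recursion (w := fun k => β • T^[k] y - T^[k + 1] y)
      (p := fun k => β ^ (k + 1) • y - T^[k + 1] y) (sub_pos.mpr hs1) hβC (fun k => ?_)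
      (hβi hβ1) (by simp) (fun k => ⟨β, 1, by linarith, zero_le_one, ?_⟩) n
      (smul_sub_mem_interior_of_bounds hu ht hn (hlb 0) (hub (n + 1)))
    · have h := hgap _ (hyk (k + 1)) _ (hyk k) β hβ (hβC k)
      rwa [← hs, ← hs] at h
    · module
  have h_ge : T y - y ∈ C := by
    obtain ⟨β, hβ, hβC, hβi⟩ := exists_sharp_limit_ratio hT (b := fun k => T^[k + 1] x)
      (a := fun k => T^[k] x) (b' := fun k => T^[k + 1] y) (a' := fun k => T^[k] y)
      hxk (fun k => hxk (k + 1)) (hs x) (fun k => hs x (k + 1)) hφ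
      hlim' (fun i => hlim' (i + 1)) (exists_comparison (hxk 1) _)
    rcases hβ.eq_or_lt with rfl | hβ1
    · simpa using hβC 0
    exfalso
    obtain ⟨n, hn⟩ := hpow β hβ1
    -- `βᵏ⁺¹ yₖ₊₁ - y₀ = (βᵏ yₖ - y₀) + βᵏ wₖ`
    refine notMem_interior_of_recursion (w := fun k => β • T^[k + 1] y - T^[k] y)
      (p := fun k => β ^ (k + 1) • T^[k + 1] y - y) (sub_pos.mpr hs1) hβC (fun k => ?_)
      (hβi hβ1) (by simp)
      (fun k => ⟨1, β ^ (k + 1), zero_le_one, pow_nonneg (by linarith) _, ?_⟩) n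
      (smul_sub_mem_interior_of_bounds hu ht hn (hlb (n + 1)) (hub 0))
    · have h := hgap _ (hyk k) _ (hyk (k + 1)) β hβ (hβC k)
      rwa [← hs, ← hs] at h
    · module
  have h : T y - y ∈ (C : Set X) ∩ -(C : Set X) := ⟨h_ge, by simpa using h_le⟩
  rw [hC] at h
  exact sub_eq_zero.mp h

end ConeIteration

theorem mainTheorem4 {X : Type*} [NormedAddCommGroup X] [NormedSpace ℝ X] [CompleteSpace X]
    (C : ProperCone ℝ X) (hC : ConeIteration.IsPointedClosedCone C)
    (hnormal : ConeIteration.IsNormalCone C)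
    (hint : (interior (C : Set X)).Nonempty)
    (f : X → X) (hf : Set.MapsTo f (interior (C : Set X)) (interior (C : Set X)))
    (hmono : ConeIteration.OrderPreservingOn C (interior (C : Set X)) f)
    (hsub : ConeIteration.SubhomogeneousOn C (interior (C : Set X)) f)
    (γ : Set X → ℝ) (hγ : ConeIteration.IsMeasureOfNoncompactness γ)
    (hcond : ConeIteration.CondensingOn γ (interior (C : Set X)) f)
    (hfix : ∃ u ∈ interior (C : Set X), f u = u)
    (s : ℝ) (hs0 : 0 < s) (hs1 : s < 1)
    (x : X) (hx : x ∈ interior (C : Set X)) :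
    ∃ z ∈ interior (C : Set X), f z = z ∧
      Filter.Tendsto (fun k : ℕ => (ConeIteration.averagedMap s f)^[k] x) Filter.atTop (nhds z) := by

  have hfr := hmono.ratioNonexpansiveOn hsub
  have hT := hfr.averagedMap hs0.le hs1.le
  have hm := ConeIteration.averagedMap_mapsTo hs0 hs1 hf
  obtain ⟨u, hu, hfu⟩ := hfix
  have hTu : ConeIteration.averagedMap s f u = u := by
    simp [ConeIteration.averagedMap, hfu, sub_smul]
  obtain ⟨t₁, ht₁, h₁⟩ := ConeIteration.exists_comparison hu x
  obtain ⟨t₂, ht₂, h₂⟩ := ConeIteration.exists_comparison hx u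
  obtain ⟨t, ht, hub₀, hlb₀⟩ : ∃ t : ℝ, 1 ≤ t ∧ t • u - x ∈ C ∧ t • x - u ∈ C :=
    ⟨max t₁ t₂, le_max_of_le_left ht₁,
      ConeIteration.smul_sub_mem_of_le (interior_subset hu) (le_max_left _ _) h₁,
      ConeIteration.smul_sub_mem_of_le (interior_subset hx) (le_max_right _ _) h₂⟩
  have ht0 : 0 < t := zero_lt_one.trans_le ht
  -- the order interval between `t⁻¹ u` and `t u` is invariant
  have hub : ∀ z ∈ interior (C : Set X), t • u - z ∈ C →
      ∀ k, t • u - (ConeIteration.averagedMap s f)^[k] z ∈ C := by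
    intro z hz h k
    have h' := hT.iterate hm k z hz u hu t ht h
    rwa [Function.iterate_fixed hTu] at h'
  have hlb : ∀ z ∈ interior (C : Set X), t • z - u ∈ C →
      ∀ k, t • (ConeIteration.averagedMap s f)^[k] z - u ∈ C := by
    intro z hz h k
    have h' := hT.iterate hm k u hu z hz t ht h
    rwa [Function.iterate_fixed hTu] at h'
  set T := ConeIteration.averagedMap s f with hTdef
  have hBD : Set.range (fun k => T^[k] x) ⊆ interior (C : Set X) := by
    rintro _ ⟨k, rfl⟩
    exact hm.iterate k hx
  have hcpt : IsCompact (closure (Set.range fun k => T^[k] x)) := by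
    refine ConeIteration.isCompact_closure_of_condensing hγ hcond hs0 hs1 (x := x) hBD
      (hnormal.isBounded (u := u) (t := t) ?_) (hnormal.isBounded (u := u) (t := t) ?_) ?_
    · rintro _ ⟨k, rfl⟩
      exact ⟨interior_subset (hm.iterate k hx), hub x hx hub₀ k⟩
    · rintro _ ⟨_, ⟨k, rfl⟩, rfl⟩
      have hk := hm.iterate k hx
      have h := hfr _ hk u hu t ht (hub x hx hub₀ k)
      rw [hfu] at h
      exact ⟨interior_subset (hf hk), h⟩
    · rintro _ ⟨_ | k, rfl⟩
      · exact Or.inl rfl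
      · exact Or.inr ⟨_, ⟨k, rfl⟩, (Function.iterate_succ_apply' T k x).symm⟩
  obtain ⟨y, -, φ, hφ, hlim⟩ :=
    hcpt.tendsto_subseq fun k => subset_closure (Set.mem_range_self k)
  have hyub : t • u - y ∈ C :=
    C.isClosed.mem_of_tendsto (tendsto_const_nhds.sub hlim)
      (Filter.Eventually.of_forall fun j => hub x hx hub₀ (φ j))
  have hylb : t • y - u ∈ C :=
    C.isClosed.mem_of_tendsto ((hlim.const_smul t).sub tendsto_const_nhds)
      (Filter.Eventually.of_forall fun j => hlb x hx hlb₀ (φ j))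
  have hy : y ∈ interior (C : Set X) :=
    ConeIteration.mem_interior_of_smul_sub_mem hu ht0 hylb
  have hTy : T y = y :=
    ConeIteration.averagedMap_eq_self_of_tendsto_iterate hC hnormal hf hfr hs0 hs1 ht0 hu hx hy
      (hub y hy hyub) (hlb y hy hylb) hφ.tendsto_atTop hlim
  refine ⟨y, hy, ?_, hT.tendsto_iterate hnormal hm hx hy hTy hlim⟩
  have h : s • (f y - y) = 0 := by
    rw [← sub_eq_zero.mpr hTy, hTdef, ConeIteration.averagedMap]
    module
  exact sub_eq_zero.mp ((smul_eq_zero.mp h).resolve_left hs0.ne')
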